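/- Let $0<p<1$ be fixed, put $q=1-p$, and let $\log$ denote the logarithm with base $1/q$. Let $\mathbf G$ be the random graph on $n$ labelled vertices in which each pair of distinct vertices is joined by an edge independently with probability $p$ (so a graph with $M$ edges has probability $p^{M}q^{\binom n2-M}$). For a finite simple graph $G$, a set $X\subseteq V(G)$ is a dominating set if every vertex not in $X$ is adjacent to a vertex in $X$. A dominating set $X$ is total if every vertex of $X$ is adjacent to a vertex of $X$; restrained if every vertex of $V(G)\setminus X$ is adjacent to a vertex of $V(G)\setminus X$; and total restrained if it is both total and restrained. Let $\gamma(G)$, $\gamma_t(G)$, $\gamma_r(G)$ and $\gamma_{tr}(G)$ denote the minimum cardinality of a dominating, total dominating, restrained dominating and total restrained dominating set of $G$, respectively ($\gamma_t$ and $\gamma_{tr}$ being defined when such sets exist). Then, with probability tending to $1$ as $n\to\infty$, the graph $G=\mathbf G$ has a total restrained dominating set and satisfies $$\gamma_r(G)=\gamma(G),\qquad \gamma_{tr}(G)=\gamma_t(G),$$ and moreover $$\gamma_r(G)=\lfloor \log n-2\log\log n+\log\log e\rfloor+\epsilon\quad\text{for some }\epsilon=\epsilon(G)\in\{1,2\}.$$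 -/

import Mathlib

open Filter Topology MeasureTheory

namespace SimpleGraph

/-- `X` is a dominating set: every vertex not in `X` is adjacent to a vertex in `X`. -/
def IsDominatingSet {V : Type*} (G : SimpleGraph V) (X : Finset V) : Prop :=
  ∀ v, v ∉ X → ∃ u ∈ X, G.Adj v u

/-- `X` is a total dominating set: a dominating set such that every vertex of `X` is adjacent
to a vertex of `X`. -/
def IsTotalDominatingSet {V : Type*} (G : SimpleGraph V) (X : Finset V) : Prop :=
  G.IsDominatingSet X ∧ ∀ v ∈ X, ∃ u ∈ X, G.Adj v u

/-- `X` is a restrained dominating set: a dominating set such that every vertex outside `X` is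
adjacent to a vertex outside `X`. -/
def IsRestrainedDominatingSet {V : Type*} (G : SimpleGraph V) (X : Finset V) : Prop :=
  G.IsDominatingSet X ∧ ∀ v, v ∉ X → ∃ u, u ∉ X ∧ G.Adj v u

/-- `X` is a total restrained dominating set: a restrained dominating set such that every vertex
of `X` is adjacent to a vertex of `X`. -/
def IsTotalRestrainedDominatingSet {V : Type*} (G : SimpleGraph V) (X : Finset V) : Prop :=
  G.IsRestrainedDominatingSet X ∧ ∀ v ∈ X, ∃ u ∈ X, G.Adj v u

/-- The domination number: the minimum cardinality of a dominating set. (For a finite graph the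
set of all vertices is dominating, so the minimum exists.) -/
noncomputable def dominationNumber {V : Type*} (G : SimpleGraph V) : ℕ :=
  sInf {k | ∃ X : Finset V, G.IsDominatingSet X ∧ X.card = k}

/-- The total domination number: the minimum cardinality of a total dominating set. (It is only
meaningful for graphs that have a total dominating set, i.e. without isolated vertices.) -/
noncomputable def totalDominationNumber {V : Type*} (G : SimpleGraph V) : ℕ :=
  sInf {k | ∃ X : Finset V, G.IsTotalDominatingSet X ∧ X.card = k}

/-- The restrained domination number: the minimum cardinality of a restrained dominating set.
(For a finite graph the set of all vertices is one, so the minimum exists.) -/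
noncomputable def restrainedDominationNumber {V : Type*} (G : SimpleGraph V) : ℕ :=
  sInf {k | ∃ X : Finset V, G.IsRestrainedDominatingSet X ∧ X.card = k}

/-- The total restrained domination number: the minimum cardinality of a total restrained
dominating set. (It is only meaningful for graphs that have such a set, i.e. without isolated
vertices.) -/
noncomputable def totalRestrainedDominationNumber {V : Type*} (G : SimpleGraph V) : ℕ :=
  sInf {k | ∃ X : Finset V, G.IsTotalRestrainedDominatingSet X ∧ X.card = k}

/-- Almost every graph (for the edge probability `p`) satisfies `Q`: the probability that the
binomial random graph on `n` labelled vertices has `Q` tends to `1` as `n → ∞`. -/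
def AlmostEvery (p : unitInterval) (Q : (n : ℕ) → SimpleGraph (Fin n) → Prop) : Prop :=
  Tendsto (fun n : ℕ => binomialRandom (Fin n) p {G | Q n G}) atTop (𝓝 1)

end SimpleGraph

/-!
Put `q = 1 - p` and let `s` be the threshold `log n - 2 log log n + log log e`, logarithms to base
`1 / q`. It is chosen so that `n q ^ s = log n ⬝ ln n` (`natCast_mul_rpow_dominationThreshold`).
A fixed set of size `r` dominates with probability `(1 - q ^ r) ^ (n - r)`, about
`exp (-n q ^ r)`, while the number of such sets is about `exp (r ln n)`. Write `k` for the integer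
part of `s`; everything follows from three events of probability tending to `1`.

* No set of size `k` dominates. For `r ≤ s` the exponent `n q ^ r` is at least `log n ⬝ ln n`, which
  beats `r ln n` because `log n - s` tends to infinity; this is the union bound
  `first_moment_bound`.
* Some set of size `r = k + 2` dominates. Here `r ≥ s + 1`, so `n q ^ r ≤ q ⬝ log n ⬝ ln n`.
  The second moment method is applied to the transversals of `r` disjoint blocks of `n / r` vertices.
  If two transversals share `j` vertices, the convexity of `q ^ x` bounds the correlation of the two
  events by `θ ^ j` with `θ = n ^ q'`, where `q < q' < 1` (`measureReal_inter_le_pow`). For random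
  transversals `j` is binomial, so the mean of `θ ^ j` is the `r`-th power of about
  `1 + θ r / n`, which tends to `1` (`second_moment_bound`).
* No set of at most `2 (k + 2)` vertices covers the neighbourhood of a vertex, again by a union bound
  (`cover_neighborhood_bound`). Hence all dominating sets of that size are restrained.

The first two events place the domination number in `{k + 1, k + 2}`. A dominating set of size
`k + 2` becomes total when a neighbour of each of its vertices is added, so the total domination
number is at most `2 (k + 2)`, and the third event turns minimum dominating and minimum total
dominating sets into restrained ones (`dominationNumbers_of_expansion`).

Independence enters through events determined by disjoint sets of pairs of vertices
(`measureReal_inter_of_disjoint`).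
-/

/-! ### Independence in the binomial random graph -/

namespace SimpleGraph

open ProbabilityTheory unitInterval

variable {V : Type*}

/-- The event `A` depends only on which pairs in `S` are edges. -/
def DeterminedBy (A : Set (SimpleGraph V)) (S : Set (Sym2 V)) : Prop :=
  ∀ G H : SimpleGraph V, (∀ e ∈ S, e ∈ G.edgeSet ↔ e ∈ H.edgeSet) → (G ∈ A ↔ H ∈ A)

instance [Finite V] : DiscreteMeasurableSpace (SimpleGraph V) where
  forall_measurableSet s := by
    rw [← measurableEmbedding_edgeSet.measurableSet_image]
    exact (Set.toFinite _).measurableSet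

/-- The edge set of the binomial random graph has the Bernoulli product law on the non-diagonal
pairs. -/
lemma binomialRandom_preimage_edgeSet [Finite V] (p : I) (B : Set (Set (Sym2 V))) :
    binomialRandom V p (edgeSet ⁻¹' B) = setBernoulli (Sym2.diagSetᶜ) p B := by
  have hae : ∀ᵐ S ∂(setBernoulli (Sym2.diagSetᶜ : Set (Sym2 V)) p),
      S ∈ Set.range (edgeSet (V := V)) := by
    filter_upwards [setBernoulli_ae_subset] with S hS
    exact ⟨fromEdgeSet S, by
      simpa [← Set.compl_ofPred, Set.subset_compl_iff_disjoint_right] using hS⟩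
  rw [binomialRandom_apply', Set.image_preimage_eq_inter_range]
  exact measure_congr (by
    filter_upwards [hae] with S hS
    exact propext ⟨fun h => h.1, fun h => ⟨h, hS⟩⟩)

lemma iIndepFun_mem_edgeSet [Finite V] (p : I) :
    iIndepFun (fun (e : Sym2 V) (G : SimpleGraph V) => e ∈ G.edgeSet) (binomialRandom V p) := by
  have h := iIndepFun_infinitePi (X := fun (_ : Sym2 V) (x : Prop) => x)
    (P := fun e : Sym2 V => toNNReal p • Measure.dirac (e ∈ (Sym2.diagSetᶜ : Set (Sym2 V))) +
      toNNReal (σ p) • Measure.dirac False) (fun _ => measurable_id)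
  rw [iIndepFun_iff_measure_inter_preimage_eq_mul] at h ⊢
  intro S sets hs
  have key : ∀ B : Set (Set (Sym2 V)), binomialRandom V p (edgeSet ⁻¹' B) = _ :=
    fun B => (binomialRandom_preimage_edgeSet p B).trans (setBernoulli_apply' B)
  have h1 := key (⋂ e ∈ S, (fun T : Set (Sym2 V) => e ∈ T) ⁻¹' sets e)
  have h2 := fun e => key ((fun T : Set (Sym2 V) => e ∈ T) ⁻¹' sets e)
  simp only [Set.preimage_iInter, Set.preimage_preimage, Set.mem_ofPred_eq] at h1 h2
  rw [h1, h S hs]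
  exact Finset.prod_congr rfl fun e _ => (h2 e).symm

/-- Events determined by disjoint sets of pairs are independent. -/
lemma measureReal_inter_of_disjoint [Finite V] (p : I) {A B : Set (SimpleGraph V)}
    {S T : Set (Sym2 V)} (hA : DeterminedBy A S) (hB : DeterminedBy B T) (hST : Disjoint S T) :
    (binomialRandom V p).real (A ∩ B) =
      (binomialRandom V p).real A * (binomialRandom V p).real B := by
  classical
  have := Fintype.ofFinite V
  have hi := (iIndepFun_mem_edgeSet (V := V) p).indepFun_finset S.toFinite.toFinset
    T.toFinite.toFinset (by simpa using hST) (fun e => .of_discrete)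
  have pre : ∀ (A : Set (SimpleGraph V)) (S : Set (Sym2 V)), DeterminedBy A S →
      A = (fun G (e : S.toFinite.toFinset) => (e : Sym2 V) ∈ G.edgeSet) ⁻¹'
        ((fun G (e : S.toFinite.toFinset) => (e : Sym2 V) ∈ G.edgeSet) '' A) := by
    intro A S hA
    refine Set.Subset.antisymm (Set.subset_preimage_image _ _) ?_
    rintro G ⟨H, hH, hGH⟩
    refine (hA H G fun e he => ?_).1 hH
    exact iff_of_eq (congrFun hGH ⟨e, by simpa using he⟩)
  have h := hi.measure_inter_preimage_eq_mul _ _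
    (Set.toFinite ((fun G (e : S.toFinite.toFinset) => (e : Sym2 V) ∈ G.edgeSet) '' A)).measurableSet
    (Set.toFinite ((fun G (e : T.toFinite.toFinset) => (e : Sym2 V) ∈ G.edgeSet) '' B)).measurableSet
  rw [← pre A S hA, ← pre B T hB] at h
  simp [measureReal_def, h]

lemma measureReal_not_adj [Finite V] (p : I) {u v : V} (h : u ≠ v) :
    (binomialRandom V p).real {G | ¬ G.Adj u v} = 1 - p := by
  have h1 := (binomialRandom_preimage_edgeSet p {T : Set (Sym2 V) | s(u, v) ∉ T}).trans
    (setBernoulli_apply' _)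
  have h2 : (fun P : Sym2 V → Prop => {i | P i}) ⁻¹' {T | s(u, v) ∉ T} =
      (fun P : Sym2 V → Prop => P s(u, v)) ⁻¹' {False} := by
    ext; simp
  have h3 : edgeSet ⁻¹' {T : Set (Sym2 V) | s(u, v) ∉ T} = {G : SimpleGraph V | ¬ G.Adj u v} := by
    ext; simp
  rw [h3, h2, ← Measure.map_apply (by fun_prop) (Set.toFinite _).measurableSet,
    Measure.infinitePi_map_eval] at h1
  rw [measureReal_def, h1]
  simp [h]

lemma DeterminedBy.inter {A B : Set (SimpleGraph V)} {S T : Set (Sym2 V)}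
    (hA : DeterminedBy A S) (hB : DeterminedBy B T) : DeterminedBy (A ∩ B) (S ∪ T) :=
  fun G H h => and_congr (hA G H fun e he => h e (.inl he)) (hB G H fun e he => h e (.inr he))

lemma DeterminedBy.mono {A : Set (SimpleGraph V)} {S T : Set (Sym2 V)}
    (hA : DeterminedBy A S) (hST : S ⊆ T) : DeterminedBy A T :=
  fun G H h => hA G H fun e he => h e (hST he)

lemma measureReal_forall_not_adj [Finite V] (p : I) {v : V} {X : Finset V} (hv : v ∉ X) :
    (binomialRandom V p).real {G | ∀ u ∈ X, ¬ G.Adj v u} = (1 - p : ℝ) ^ X.card := by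
  classical
  induction X using Finset.induction_on with
  | empty => simp
  | insert a X ha ih =>
    simp only [Finset.mem_insert, not_or] at hv
    have h1 : {G : SimpleGraph V | ∀ u ∈ insert a X, ¬ G.Adj v u} =
        {G | ¬ G.Adj v a} ∩ {G | ∀ u ∈ X, ¬ G.Adj v u} := by
      ext; simp
    rw [h1, measureReal_inter_of_disjoint p (S := {s(v, a)}) (T := {e | ∃ u ∈ X, e = s(v, u)}),
      measureReal_not_adj p hv.1, ih hv.2, Finset.card_insert_of_notMem ha, pow_succ']
    · intro G H h
      simpa using not_congr (h _ rfl)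
    · intro G H h
      exact forall₂_congr fun u hu => not_congr (h s(v, u) ⟨u, hu, rfl⟩)
    · rw [Set.disjoint_singleton_left]
      rintro ⟨u, hu, h⟩
      rcases Sym2.eq_iff.1 h with ⟨-, h⟩ | ⟨h, h'⟩
      · exact ha (h ▸ hu)
      · exact hv.1 h'.symm

/-- Events about the neighbourhoods inside `T` of distinct vertices outside `T` are independent. -/
lemma measureReal_biInter [Finite V] (p : I) {T W : Finset V} (hTW : Disjoint T W)
    (A : V → Set (SimpleGraph V))
    (hA : ∀ v ∈ W, DeterminedBy (A v) {e | ∃ u ∈ T, e = s(v, u)}) :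
    (binomialRandom V p).real (⋂ v ∈ W, A v) = ∏ v ∈ W, (binomialRandom V p).real (A v) := by
  classical
  suffices h : DeterminedBy (⋂ v ∈ W, A v) {e | ∃ v ∈ W, ∃ u ∈ T, e = s(v, u)} ∧
      (binomialRandom V p).real (⋂ v ∈ W, A v) = ∏ v ∈ W, (binomialRandom V p).real (A v) from h.2
  induction W using Finset.induction_on with
  | empty => exact ⟨fun G H _ => by simp, by simp⟩
  | insert a W ha ih =>
    obtain ⟨ih1, ih2⟩ := ih (hTW.mono_right (Finset.subset_insert _ _))
      fun v hv => hA v (Finset.mem_insert_of_mem hv)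
    have haA := hA a (Finset.mem_insert_self _ _)
    rw [Finset.set_biInter_insert]
    refine ⟨(haA.inter ih1).mono ?_, ?_⟩
    · rintro e (⟨u, hu, rfl⟩ | ⟨v, hv, u, hu, rfl⟩)
      · exact ⟨a, Finset.mem_insert_self _ _, u, hu, rfl⟩
      · exact ⟨v, Finset.mem_insert_of_mem hv, u, hu, rfl⟩
    · rw [measureReal_inter_of_disjoint p haA ih1, ih2, Finset.prod_insert ha]
      rw [Set.disjoint_left]
      rintro e ⟨u, hu, rfl⟩ ⟨v, hv, u', hu', h⟩
      rcases Sym2.eq_iff.1 h with ⟨h, -⟩ | ⟨h, -⟩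
      · exact ha (h ▸ hv)
      · exact Finset.disjoint_left.1 hTW hu' (h ▸ Finset.mem_insert_self _ _)

lemma determinedBy_exists_adj (v : V) {X T : Finset V} (hXT : X ⊆ T) :
    DeterminedBy {G : SimpleGraph V | ∃ u ∈ X, G.Adj v u} {e | ∃ u ∈ T, e = s(v, u)} :=
  fun _ _ h => exists_congr fun u => and_congr_right fun hu => h s(v, u) ⟨u, hXT hu, rfl⟩

lemma measureReal_exists_adj [Finite V] (p : I) {v : V} {X : Finset V} (hv : v ∉ X) :
    (binomialRandom V p).real {G | ∃ u ∈ X, G.Adj v u} = 1 - (1 - p : ℝ) ^ X.card := by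
  rw [← measureReal_forall_not_adj p hv, ← probReal_compl_eq_one_sub (Set.toFinite _).measurableSet]
  congr 1
  ext G
  simp

lemma measureReal_exists_adj_inter [Finite V] [DecidableEq V] (p : I) {v : V} {X Y : Finset V}
    (hX : v ∉ X) (hY : v ∉ Y) :
    (binomialRandom V p).real ({G | ∃ u ∈ X, G.Adj v u} ∩ {G | ∃ u ∈ Y, G.Adj v u}) =
      1 - (1 - p : ℝ) ^ X.card - (1 - p : ℝ) ^ Y.card + (1 - p : ℝ) ^ (X ∪ Y).card := by
  have h := measureReal_union_add_inter (μ := binomialRandom V p) (s := {G | ∃ u ∈ X, G.Adj v u})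
    (t := {G | ∃ u ∈ Y, G.Adj v u}) (Set.toFinite _).measurableSet
  have hu : {G : SimpleGraph V | ∃ u ∈ X, G.Adj v u} ∪ {G | ∃ u ∈ Y, G.Adj v u} =
      {G | ∃ u ∈ X ∪ Y, G.Adj v u} := by
    ext G
    simp only [Set.mem_union, Set.mem_ofPred_eq, Finset.mem_union, or_and_right, exists_or]
  rw [hu, measureReal_exists_adj p hX, measureReal_exists_adj p hY,
    measureReal_exists_adj p (by simp [hX, hY])] at h
  linarith

lemma measureReal_isDominatingSet [Fintype V] (p : I) (X : Finset V) :
    (binomialRandom V p).real {G | G.IsDominatingSet X} =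
      (1 - (1 - p : ℝ) ^ X.card) ^ (Fintype.card V - X.card) := by
  classical
  have h : {G : SimpleGraph V | G.IsDominatingSet X} = ⋂ v ∈ Xᶜ, {G | ∃ u ∈ X, G.Adj v u} := by
    ext; simp [IsDominatingSet]
  rw [h, measureReal_biInter p disjoint_compl_right _
    fun v _ => determinedBy_exists_adj v subset_rfl,
    Finset.prod_congr rfl fun v hv => measureReal_exists_adj p (Finset.mem_compl.1 hv)]
  simp [Finset.card_compl]

/-- The probability that two fixed sets are both dominating. Only the requirement on the vertices
outside `X ∪ Y` is used, which loses a factor that is negligible for small sets. -/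
lemma measureReal_isDominatingSet_inter_le [Fintype V] [DecidableEq V] (p : I) (X Y : Finset V) :
    (binomialRandom V p).real ({G | G.IsDominatingSet X} ∩ {G | G.IsDominatingSet Y}) ≤
      (1 - (1 - p : ℝ) ^ X.card - (1 - p : ℝ) ^ Y.card + (1 - p : ℝ) ^ (X ∪ Y).card) ^
        (Fintype.card V - (X ∪ Y).card) := by
  have h : {G : SimpleGraph V | G.IsDominatingSet X} ∩ {G | G.IsDominatingSet Y} ⊆
      ⋂ v ∈ (X ∪ Y)ᶜ, ({G | ∃ u ∈ X, G.Adj v u} ∩ {G | ∃ u ∈ Y, G.Adj v u}) := by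
    rintro G ⟨h1, h2⟩
    simp only [Set.mem_iInter, Finset.mem_compl, Finset.mem_union, not_or]
    exact fun v hv => ⟨h1 v hv.1, h2 v hv.2⟩
  refine (measureReal_mono h).trans_eq ?_
  rw [measureReal_biInter p disjoint_compl_right, Finset.prod_congr rfl
    fun v hv => measureReal_exists_adj_inter p (X := X) (Y := Y) ?_ ?_]
  · rw [Finset.prod_const, Finset.card_compl]
  · simp_all
  · simp_all
  · intro v _
    have h := (determinedBy_exists_adj v (Finset.subset_union_left (s₁ := X) (s₂ := Y))).inter
      (determinedBy_exists_adj v (Finset.subset_union_right (s₁ := X) (s₂ := Y)))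
    rwa [Set.union_self] at h
end SimpleGraph

/-! ### Domination numbers of a graph without small neighbourhoods -/

namespace SimpleGraph
variable {V : Type*}

lemma IsDominatingSet.mono {G : SimpleGraph V} {X Y : Finset V} (hX : G.IsDominatingSet X)
    (hXY : X ⊆ Y) : G.IsDominatingSet Y := fun v hv =>
  let ⟨u, hu, h⟩ := hX v fun hvX => hv (hXY hvX)
  ⟨u, hXY hu, h⟩

/-- Adding a neighbour of each of its vertices to a dominating set makes it total. -/
lemma IsDominatingSet.exists_isTotalDominatingSet {G : SimpleGraph V} {X : Finset V}
    (hX : G.IsDominatingSet X) (hG : ∀ v, ∃ u, G.Adj v u) :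
    ∃ Y : Finset V, G.IsTotalDominatingSet Y ∧ Y.card ≤ 2 * X.card := by
  classical
  choose f hf using hG
  have hdom : ∀ v, v ∉ X → ∃ u ∈ X ∪ X.image f, G.Adj v u := fun v hv =>
    let ⟨u, hu, h⟩ := hX v hv
    ⟨u, Finset.mem_union_left _ hu, h⟩
  refine ⟨X ∪ X.image f, ⟨hX.mono Finset.subset_union_left, fun v _ => ?_⟩, ?_⟩
  · by_cases hv : v ∈ X
    · exact ⟨f v, Finset.mem_union_right _ (Finset.mem_image_of_mem f hv), hf v⟩
    · exact hdom v hv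
  · have h1 := Finset.card_union_le X (X.image f)
    have h2 := Finset.card_image_le (s := X) (f := f)
    omega

section Infima
variable {P Q : Finset V → Prop}

lemma exists_card_eq_sInf (h : ∃ X, P X) :
    ∃ X : Finset V, P X ∧ X.card = sInf {k | ∃ X : Finset V, P X ∧ X.card = k} := by
  obtain ⟨X, hX⟩ := h
  exact Nat.sInf_mem (s := {k | ∃ X : Finset V, P X ∧ X.card = k}) ⟨_, X, hX, rfl⟩

lemma sInf_card_le {X : Finset V} (hX : P X) :
    sInf {k | ∃ X : Finset V, P X ∧ X.card = k} ≤ X.card :=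
  Nat.sInf_le ⟨X, hX, rfl⟩

/-- If `Q` is stronger than `P` but the two agree on sets of size at most `d`, and some set of size
at most `d` satisfies `P`, then their minimum cardinalities agree. -/
lemma sInf_card_eq_of_agree (d : ℕ) (hQP : ∀ X, Q X → P X)
    (hPQ : ∀ X : Finset V, X.card ≤ d → P X → Q X) (h : ∃ X, P X ∧ X.card ≤ d) :
    sInf {k | ∃ X : Finset V, Q X ∧ X.card = k} =
      sInf {k | ∃ X : Finset V, P X ∧ X.card = k} := by
  obtain ⟨X, hX, hXd⟩ := h
  obtain ⟨Y, hY, hYc⟩ := exists_card_eq_sInf ⟨X, hX⟩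
  have hYd : Y.card ≤ d := hYc ▸ (sInf_card_le hX).trans hXd
  refine le_antisymm ((sInf_card_le (hPQ Y hYd hY)).trans_eq hYc) ?_
  obtain ⟨Z, hZ, hZc⟩ := exists_card_eq_sInf ⟨Y, hPQ Y hYd hY⟩
  exact (sInf_card_le (hQP Z hZ)).trans_eq hZc

end Infima

/-- If no set of at most `2 * (k + 2)` vertices covers a neighbourhood, then every dominating set of
at most that size is restrained. Minimum dominating sets and minimum total dominating sets are that
small, the latter because a dominating set can be made total by at most doubling it. -/
lemma dominationNumbers_of_expansion [Fintype V] {G : SimpleGraph V} {k : ℕ}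
    (hk : k ≤ Fintype.card V)
    (hdeg : ∀ X : Finset V, X.card ≤ 2 * (k + 2) → ∀ v, ∃ u, u ∉ X ∧ G.Adj v u)
    (hno : ¬ ∃ X : Finset V, G.IsDominatingSet X ∧ X.card = k)
    (hyes : ∃ X : Finset V, G.IsDominatingSet X ∧ X.card = k + 2) :
    G.restrainedDominationNumber = G.dominationNumber ∧
      (∃ X : Finset V, G.IsTotalRestrainedDominatingSet X) ∧
      G.totalRestrainedDominationNumber = G.totalDominationNumber ∧
      (G.restrainedDominationNumber = k + 1 ∨ G.restrainedDominationNumber = k + 2) := by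
  obtain ⟨D, hD, hDc⟩ := hyes
  have hiso : ∀ v, ∃ u, G.Adj v u := fun v =>
    let ⟨u, _, hu⟩ := hdeg ∅ (by simp) v
    ⟨u, hu⟩
  obtain ⟨T, hT, hTc⟩ := hD.exists_isTotalDominatingSet hiso
  rw [hDc] at hTc
  have hr : G.restrainedDominationNumber = G.dominationNumber :=
    sInf_card_eq_of_agree (2 * (k + 2)) (fun X h => h.1)
      (fun X hX h => ⟨h, fun v _ => hdeg X hX v⟩) ⟨D, hD, by omega⟩
  refine ⟨hr, ⟨T, ⟨hT.1, fun v _ => hdeg T hTc v⟩, hT.2⟩,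
    sInf_card_eq_of_agree (2 * (k + 2)) (fun X h => ⟨h.1.1, h.2⟩)
      (fun X hX h => ⟨⟨h.1, fun v _ => hdeg X hX v⟩, h.2⟩) ⟨T, hT, hTc⟩, ?_⟩
  rw [hr]
  have hle : G.dominationNumber ≤ k + 2 := (sInf_card_le hD).trans_eq hDc
  have hlt : k < G.dominationNumber := by
    by_contra! hle
    obtain ⟨Y, hY, hYc⟩ := exists_card_eq_sInf (P := G.IsDominatingSet) ⟨D, hD⟩
    obtain ⟨Z, hYZ, hZ⟩ := Finset.exists_superset_card_eq (s := Y) (hYc.trans_le hle) hk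
    exact hno ⟨Z, hY.mono hYZ, hZ⟩
  omega

end SimpleGraph

/-! ### The second moment inequality and counting -/

/-- The second moment inequality for events: Cauchy-Schwarz applied to the number of events that
occur and to the indicator of their union. -/
lemma sq_sum_measureReal_le {Ω ι : Type*} [Finite Ω] [MeasurableSpace Ω]
    [DiscreteMeasurableSpace Ω] (μ : Measure Ω) [IsFiniteMeasure μ] (s : Finset ι)
    (A : ι → Set Ω) :
    (∑ i ∈ s, μ.real (A i)) ^ 2 ≤
      μ.real (⋃ i ∈ s, A i) * ∑ i ∈ s, ∑ j ∈ s, μ.real (A i ∩ A j) := by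
  set U := ⋃ i ∈ s, A i with hU
  let f : Ω → ℝ := fun ω => ∑ i ∈ s, (A i).indicator 1 ω
  have hint : ∀ g : Ω → ℝ, Integrable g μ := fun g => .of_finite
  have hind : ∀ B : Set Ω, ∫ ω, B.indicator 1 ω ∂μ = μ.real B := fun B =>
    integral_indicator_one (Set.toFinite _).measurableSet
  have h1 : ∫ ω, f ω ∂μ = ∑ i ∈ s, μ.real (A i) := by
    simp only [f]
    rw [integral_finsetSum _ fun i _ => hint _]
    exact Finset.sum_congr rfl fun i _ => hind _
  have h2 : ∫ ω, f ω ^ 2 ∂μ = ∑ i ∈ s, ∑ j ∈ s, μ.real (A i ∩ A j) := by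
    simp only [f, sq, Finset.sum_mul_sum]
    rw [integral_finsetSum _ fun i _ => hint _]
    refine Finset.sum_congr rfl fun i _ => ?_
    rw [integral_finsetSum _ fun i _ => hint _]
    refine Finset.sum_congr rfl fun j _ => ?_
    rw [← hind]
    congr 1
    ext ω
    rw [Set.inter_indicator_one, Pi.mul_apply]
  have hf : ∀ ω, U.indicator 1 ω * f ω = f ω := by
    intro ω
    by_cases h : ω ∈ U
    · simp [h]
    · have : f ω = 0 := Finset.sum_eq_zero fun i hi =>
        Set.indicator_of_notMem (fun hω => h (Set.mem_biUnion hi hω)) _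
      simp [this]
  -- `0 ≤ ∫ (1_U - t f)²` for all `t`, so this quadratic in `t` has nonpositive discriminant.
  have hq : ∀ t : ℝ, 0 ≤ (∑ i ∈ s, ∑ j ∈ s, μ.real (A i ∩ A j)) * (t * t) +
      (-2 * ∑ i ∈ s, μ.real (A i)) * t + μ.real U := by
    intro t
    have h0 : 0 ≤ ∫ ω, (U.indicator 1 ω - t * f ω) ^ 2 ∂μ :=
      integral_nonneg fun ω => sq_nonneg _
    have he : ∀ ω, (U.indicator 1 ω - t * f ω) ^ 2 =
        U.indicator 1 ω + (-2 * t) * f ω + t ^ 2 * f ω ^ 2 := by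
      intro ω
      have hU2 : (U.indicator 1 ω : ℝ) ^ 2 = U.indicator 1 ω := by
        by_cases h : ω ∈ U <;> simp [h]
      linear_combination hU2 - 2 * t * hf ω
    simp_rw [he] at h0
    rw [integral_add (hint _) (hint _), integral_add (hint _) (hint _), integral_const_mul,
      integral_const_mul, h1, h2, hind] at h0
    linarith
  have := discrim_le_zero hq
  rw [discrim] at this
  linarith

lemma measureReal_sub_sub_le {Ω : Type*} [MeasurableSpace Ω] {μ : Measure Ω} [IsFiniteMeasure μ]
    {A B C Q : Set Ω} (h : C ⊆ Q ∪ B ∪ A) : μ.real C - μ.real B - μ.real A ≤ μ.real Q := by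
  linarith [measureReal_mono (μ := μ) h, measureReal_union_le (μ := μ) (Q ∪ B) A,
    measureReal_union_le (μ := μ) Q B]

/-- The generating function of the number of coincidences of two functions, which factors over
`α`. -/
lemma sum_pow_card_coincidences {α β : Type*} [Fintype α] [DecidableEq α] [Fintype β]
    [DecidableEq β] (θ : ℝ) :
    ∑ f : α → β, ∑ g : α → β, θ ^ (Finset.univ.filter fun i => f i = g i).card =
      (Fintype.card β : ℝ) ^ Fintype.card α *
        (Fintype.card β - 1 + θ) ^ Fintype.card α := by
  have h : ∀ f : α → β, ∑ g : α → β, θ ^ (Finset.univ.filter fun i => f i = g i).card =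
      (Fintype.card β - 1 + θ) ^ Fintype.card α := by
    intro f
    have h1 : ∀ g : α → β, θ ^ (Finset.univ.filter fun i => f i = g i).card =
        ∏ i, if f i = g i then θ else 1 := by
      intro g
      rw [Finset.prod_ite]; simp
    simp_rw [h1]
    rw [← Fintype.piFinset_univ,
      ← Finset.prod_univ_sum (fun _ : α => (Finset.univ : Finset β))
      (fun i b => if f i = b then θ else 1)]
    have h2 : ∀ i, ∑ b : β, (if f i = b then θ else 1) = Fintype.card β - 1 + θ := by
      intro i
      have : ∀ b, (if f i = b then θ else 1) = 1 + if f i = b then θ - 1 else 0 := by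
        intro b; split_ifs <;> ring
      simp_rw [this]
      rw [Finset.sum_add_distrib]
      simp
      ring
    simp [h2]
  simp_rw [h]
  simp

/-- Convexity of `x ↦ q ^ x` on `[0, r]`, as the weighted inequality of arithmetic and geometric
means for `1` and `q ^ r`. -/
lemma mul_pow_sub_le {q : ℝ} (hq : 0 ≤ q) {j r : ℕ} (hr : r ≠ 0) (hj : j ≤ r) :
    q ^ (r - j) ≤ j / r + (r - j) / r * q ^ r := by
  have hr' : (0 : ℝ) < r := by positivity
  have hj' : (j : ℝ) ≤ r := by exact_mod_cast hj
  have h := Real.geom_mean_le_arith_mean2_weighted (w₁ := j / r) (w₂ := (r - j) / r) (p₁ := 1)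
    (p₂ := q ^ r) (by positivity) (div_nonneg (by linarith) hr'.le) zero_le_one (by positivity)
    (by field_simp; ring)
  rw [Real.one_rpow, one_mul, mul_one, ← Real.rpow_natCast q r, ← Real.rpow_mul hq,
    mul_div_cancel₀ _ hr'.ne', ← Nat.cast_sub hj, Real.rpow_natCast, Nat.cast_sub hj,
    Real.rpow_natCast] at h
  exact h

/-! ### Bounds for the number of dominating sets -/

namespace SimpleGraph

open unitInterval

/-- With `q = 1 - p`: for two sets of size `r` meeting in `j` vertices, the probability that both
dominate exceeds the square of the probability that one does by a factor of at most
`θ ^ j / (1 - q ^ r) ^ (2 * r)`. By convexity the correlation grows at most geometrically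
in `j`. -/
lemma measureReal_inter_le_pow {V : Type*} [Fintype V] [DecidableEq V] (p : I) (hp0 : 0 < (p : ℝ))
    (hp1 : (p : ℝ) < 1) {r : ℕ} (hr : r ≠ 0) {θ : ℝ} {X Y : Finset V} (hX : X.card = r)
    (hY : Y.card = r)
    (hθ : Real.exp (Fintype.card V * (1 - p : ℝ) ^ r / (r * (1 - (1 - p : ℝ) ^ r))) ≤ θ) :
    (1 - (1 - p : ℝ) ^ r) ^ (2 * r) *
      (binomialRandom V p).real ({G | G.IsDominatingSet X} ∩ {G | G.IsDominatingSet Y}) ≤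
      (1 - (1 - p : ℝ) ^ r) ^ (2 * (Fintype.card V - r)) * θ ^ (X ∩ Y).card := by
  have h := measureReal_isDominatingSet_inter_le p X Y
  set q : ℝ := 1 - p with hqdef
  set n := Fintype.card V with hn
  set j := (X ∩ Y).card with hj
  have hjr : j ≤ r := hX ▸ Finset.card_le_card Finset.inter_subset_left
  have hU : (X ∪ Y).card = 2 * r - j := by
    have := Finset.card_union_add_card_inter X Y
    omega
  have hUn : (X ∪ Y).card ≤ n := Finset.card_le_univ _
  have hq0 : 0 < q := by linarith
  have hq1 : q < 1 := by linarith
  have hqr0 : 0 < q ^ r := by positivity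
  have hqr : q ^ r < 1 := pow_lt_one₀ hq0.le hq1 hr
  set a := 1 - q ^ r with ha
  have ha0 : 0 < a := by linarith
  have ha1 : a ≤ 1 := by linarith
  have hr' : (0 : ℝ) < r := by positivity
  rw [hX, hY, hU] at h
  rw [hU] at hUn
  -- The probability that a vertex outside `X ∪ Y` has a neighbour in `X` and one in `Y`, against
  -- the square `a ^ 2` of the probability that it has one in `X`.
  have hB : 1 - q ^ r - q ^ r + q ^ (2 * r - j) ≤
      a ^ 2 * Real.exp (j / r * (q ^ r / a)) := by
    have h1 := mul_pow_sub_le hq0.le hr hjr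
    have h2 : q ^ (2 * r - j) = q ^ r * q ^ (r - j) := by
      rw [← pow_add]; congr 1; omega
    have h3 := Real.add_one_le_exp (j / r * (q ^ r / a))
    calc 1 - q ^ r - q ^ r + q ^ (2 * r - j)
        ≤ 1 - q ^ r - q ^ r + q ^ r * (j / r + (r - j) / r * q ^ r) := by
          rw [h2]; gcongr
      _ = a ^ 2 * (j / r * (q ^ r / a) + 1) := by
          field_simp; rw [ha]; ring
      _ ≤ _ := by gcongr
  have hB0 : 0 ≤ 1 - q ^ r - q ^ r + q ^ (2 * r - j) := by
    have : (q ^ r) ^ 2 ≤ q ^ (2 * r - j) := by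
      rw [← pow_mul]
      exact pow_le_pow_of_le_one hq0.le hq1.le (by omega)
    nlinarith [sq_nonneg (1 - q ^ r)]
  have hexp : Real.exp (j / r * (q ^ r / a)) ^ (n - (2 * r - j)) ≤ θ ^ j := by
    calc Real.exp (j / r * (q ^ r / a)) ^ (n - (2 * r - j))
        ≤ Real.exp (j / r * (q ^ r / a)) ^ n :=
          pow_le_pow_right₀ (Real.one_le_exp (by positivity)) (Nat.sub_le _ _)
      _ = Real.exp (n * q ^ r / (r * a)) ^ j := by
          rw [← Real.exp_nat_mul, ← Real.exp_nat_mul]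
          congr 1
          field_simp
      _ ≤ θ ^ j := by gcongr
  calc a ^ (2 * r) *
      (binomialRandom V p).real ({G | G.IsDominatingSet X} ∩ {G | G.IsDominatingSet Y})
      ≤ a ^ (2 * r) * (a ^ 2 * Real.exp (j / r * (q ^ r / a))) ^ (n - (2 * r - j)) := by
        gcongr
        exact h.trans (by gcongr)
    _ = a ^ (2 * r + 2 * (n - (2 * r - j))) *
        Real.exp (j / r * (q ^ r / a)) ^ (n - (2 * r - j)) := by
        rw [mul_pow, ← pow_mul, pow_add]; ring
    _ ≤ a ^ (2 * (n - r)) * θ ^ j := by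
        refine mul_le_mul (pow_le_pow_of_le_one ha0.le ha1 (by omega)) hexp (by positivity)
          (by positivity)

/-- The second moment bound for dominating sets of size `r`. Only the transversals of `r` disjoint
blocks of `m` vertices are counted: there are enough of them, and the size of the intersection of
two independent uniform transversals is a sum of independent indicators. -/
lemma second_moment_bound {n : ℕ} (p : I) (hp0 : 0 < (p : ℝ)) (hp1 : (p : ℝ) < 1) {r m : ℕ}
    (hr : r ≠ 0) (hm : m ≠ 0) (hrm : r * m ≤ n) {θ : ℝ}
    (hθ : Real.exp (n * (1 - p : ℝ) ^ r / (r * (1 - (1 - p : ℝ) ^ r))) ≤ θ) :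
    (1 - (1 - p : ℝ) ^ r) ^ (2 * r) * (m : ℝ) ^ r ≤ (m - 1 + θ) ^ r *
      (binomialRandom (Fin n) p).real
        {G | ∃ X : Finset (Fin n), G.IsDominatingSet X ∧ X.card = r} := by
  classical
  obtain ⟨e⟩ : Nonempty (Fin r × Fin m ↪ Fin n) :=
    Function.Embedding.nonempty_of_card_le (by simpa using hrm)
  -- `X f` is the transversal choosing the vertex `e (i, f i)` in the `i`-th block.
  let X : (Fin r → Fin m) → Finset (Fin n) := fun f =>
    Finset.univ.map ⟨fun i => e (i, f i), fun i j h => (Prod.ext_iff.1 (e.injective h)).1⟩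
  have hXc : ∀ f, (X f).card = r := fun f => by simp [X]
  have hXi : ∀ f g, (X f ∩ X g).card = (Finset.univ.filter fun i => f i = g i).card := by
    intro f g
    have : X f ∩ X g = (Finset.univ.filter fun i => f i = g i).map
        ⟨fun i => e (i, f i), fun i j h => (Prod.ext_iff.1 (e.injective h)).1⟩ := by
      ext v
      simp only [X, Finset.mem_inter, Finset.mem_map, Finset.mem_univ, true_and,
        Finset.mem_filter]
      constructor
      · rintro ⟨⟨i, rfl⟩, k, hk⟩
        obtain ⟨rfl, h⟩ := Prod.ext_iff.1 (e.injective hk)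
        exact ⟨k, h.symm, rfl⟩
      · rintro ⟨i, hi, rfl⟩
        exact ⟨⟨i, rfl⟩, i, congrArg (fun b => e (i, b)) hi.symm⟩
    rw [this, Finset.card_map]
  set q : ℝ := 1 - p with hq
  have hqr : q ^ r < 1 := pow_lt_one₀ (by linarith) (by linarith) hr
  set a := 1 - q ^ r with ha
  have ha0 : 0 < a := by linarith
  set μ := binomialRandom (Fin n) p with hμ
  set P := μ.real {G | ∃ X : Finset (Fin n), G.IsDominatingSet X ∧ X.card = r} with hP
  have h1 := sq_sum_measureReal_le μ Finset.univ fun f => {G | G.IsDominatingSet (X f)}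
  have hS1 : ∑ f, μ.real {G | G.IsDominatingSet (X f)} = (m : ℝ) ^ r * a ^ (n - r) := by
    simp [hμ, measureReal_isDominatingSet, hXc, ha, hq]
  have hS2 : a ^ (2 * r) * ∑ f, ∑ g, μ.real
      ({G | G.IsDominatingSet (X f)} ∩ {G | G.IsDominatingSet (X g)}) ≤
      a ^ (2 * (n - r)) * ((m : ℝ) ^ r * (m - 1 + θ) ^ r) := by
    have hsum := sum_pow_card_coincidences (α := Fin r) (β := Fin m) θ
    simp only [Fintype.card_fin] at hsum
    rw [← hsum]
    simp only [Finset.mul_sum]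
    refine Finset.sum_le_sum fun f _ => Finset.sum_le_sum fun g _ => ?_
    have := measureReal_inter_le_pow (V := Fin n) p hp0 hp1 hr (hXc f) (hXc g)
      (θ := θ) (by simpa using hθ)
    rw [hXi] at this
    simpa using this
  have hU : μ.real (⋃ f ∈ Finset.univ, {G | G.IsDominatingSet (X f)}) ≤ P := by
    refine measureReal_mono ?_
    intro G hG
    simp only [Finset.mem_univ, Set.iUnion_true, Set.mem_iUnion] at hG
    obtain ⟨f, hf⟩ := hG
    exact ⟨X f, hf, hXc f⟩
  have hP0 : 0 ≤ P := measureReal_nonneg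
  have hmain : (a ^ (2 * r) * (m : ℝ) ^ r) * ((m : ℝ) ^ r * a ^ (2 * (n - r))) ≤
      ((m - 1 + θ) ^ r * P) * ((m : ℝ) ^ r * a ^ (2 * (n - r))) := by
    rw [hS1] at h1
    calc (a ^ (2 * r) * (m : ℝ) ^ r) * ((m : ℝ) ^ r * a ^ (2 * (n - r)))
        = a ^ (2 * r) * ((m : ℝ) ^ r * a ^ (n - r)) ^ 2 := by ring
      _ ≤ a ^ (2 * r) * (P * ∑ f, ∑ g, μ.real
          ({G | G.IsDominatingSet (X f)} ∩ {G | G.IsDominatingSet (X g)})) := by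
          gcongr
          refine h1.trans ?_
          gcongr
      _ = P * (a ^ (2 * r) * ∑ f, ∑ g, μ.real
          ({G | G.IsDominatingSet (X f)} ∩ {G | G.IsDominatingSet (X g)})) := by ring
      _ ≤ P * (a ^ (2 * (n - r)) * ((m : ℝ) ^ r * (m - 1 + θ) ^ r)) := by gcongr
      _ = _ := by ring
  exact le_of_mul_le_mul_right hmain (by positivity)

lemma first_moment_bound {n : ℕ} (p : I) {r : ℕ} (hr : r ≤ n) :
    (binomialRandom (Fin n) p).real
        {G | ∃ X : Finset (Fin n), G.IsDominatingSet X ∧ X.card = r} ≤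
      (n : ℝ) ^ r * Real.exp (-((1 - p : ℝ) ^ r * (n - r))) := by
  have hp : (0 : ℝ) ≤ 1 - p := by linarith [p.2.2]
  have hp' : (1 - p : ℝ) ≤ 1 := by linarith [p.2.1]
  have h : {G : SimpleGraph (Fin n) | ∃ X : Finset (Fin n), G.IsDominatingSet X ∧ X.card = r} =
      ⋃ X ∈ Finset.univ.powersetCard r, {G | G.IsDominatingSet X} := by
    ext G; simp [and_comm]
  rw [h]
  refine (measureReal_biUnion_finset_le _ _).trans ?_
  have h1 : ∀ X ∈ (Finset.univ : Finset (Fin n)).powersetCard r,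
      (binomialRandom (Fin n) p).real {G | G.IsDominatingSet X} =
        (1 - (1 - p : ℝ) ^ r) ^ (n - r) := by
    intro X hX
    rw [measureReal_isDominatingSet, (Finset.mem_powersetCard.1 hX).2, Fintype.card_fin]
  rw [Finset.sum_congr rfl h1, Finset.sum_const, Finset.card_powersetCard, Finset.card_univ,
    Fintype.card_fin, nsmul_eq_mul]
  gcongr
  · exact pow_nonneg (by linarith [pow_le_one₀ hp hp' (n := r)]) _
  · exact_mod_cast Nat.choose_le_pow n r
  · rw [show -((1 - p : ℝ) ^ r * (n - r)) = ((n - r : ℕ) : ℝ) * (-(1 - p : ℝ) ^ r) by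
      rw [Nat.cast_sub hr]; ring, Real.exp_nat_mul]
    gcongr
    · linarith [pow_le_one₀ hp hp' (n := r)]
    · linarith [Real.add_one_le_exp (-(1 - p : ℝ) ^ r)]

lemma cover_neighborhood_bound {n : ℕ} (p : I) {d : ℕ} (hd : d < n) :
    (binomialRandom (Fin n) p).real
        {G | ¬ ∀ X : Finset (Fin n), X.card ≤ d → ∀ v, ∃ u, u ∉ X ∧ G.Adj v u} ≤
      (n : ℝ) ^ (d + 1) * (1 - p : ℝ) ^ (n - (d + 1)) := by
  classical
  have hp : (0 : ℝ) ≤ 1 - p := by linarith [p.2.2]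
  have hp' : (1 - p : ℝ) ≤ 1 := by linarith [p.2.1]
  have h : {G : SimpleGraph (Fin n) |
      ¬ ∀ X : Finset (Fin n), X.card ≤ d → ∀ v, ∃ u, u ∉ X ∧ G.Adj v u} ⊆
      ⋃ x ∈ Finset.univ ×ˢ Finset.univ.powersetCard d,
        {G | ∀ u ∈ (insert x.1 x.2)ᶜ, ¬ G.Adj x.1 u} := by
    intro G hG
    simp only [Set.mem_ofPred_eq, not_forall, not_exists, not_and] at hG
    obtain ⟨X, hX, v, hv⟩ := hG
    obtain ⟨Y, hXY, hY⟩ := Finset.exists_superset_card_eq hX (by simpa using hd.le)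
    simp only [Set.mem_iUnion]
    refine ⟨(v, Y), by simpa using hY, fun u hu => hv u fun huX => ?_⟩
    simp only [Finset.mem_compl, Finset.mem_insert, not_or] at hu
    exact hu.2 (hXY huX)
  refine (measureReal_mono h (measure_ne_top _ _)).trans ((measureReal_biUnion_finset_le _ _).trans ?_)
  have h1 : ∀ x ∈ (Finset.univ : Finset (Fin n)) ×ˢ Finset.univ.powersetCard d,
      (binomialRandom (Fin n) p).real {G | ∀ u ∈ (insert x.1 x.2)ᶜ, ¬ G.Adj x.1 u} ≤
        (1 - p : ℝ) ^ (n - (d + 1)) := by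
    rintro ⟨v, X⟩ hX
    simp only [Finset.mem_product, Finset.mem_univ, Finset.mem_powersetCard_univ, true_and] at hX
    rw [measureReal_forall_not_adj p (by simp), Finset.card_compl, Fintype.card_fin]
    refine pow_le_pow_of_le_one hp hp' ?_
    have h2 : (insert v X).card ≤ d + 1 := hX ▸ Finset.card_insert_le v X
    exact Nat.sub_le_sub_left h2 n
  refine (Finset.sum_le_sum h1).trans ?_
  rw [Finset.sum_const, Finset.card_product, Finset.card_powersetCard, Finset.card_univ,
    Fintype.card_fin, nsmul_eq_mul]
  gcongr
  rw [pow_succ']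
  exact_mod_cast Nat.mul_le_mul_left n (Nat.choose_le_pow n d)

end SimpleGraph

/-! ### Asymptotics at the threshold -/

namespace SimpleGraph

open unitInterval

/-- The real number `log n - 2 log log n + log log e`, logarithms to base `1 / q`, whose integer
part locates the domination number. -/
noncomputable def dominationThreshold (q : ℝ) (n : ℕ) : ℝ :=
  Real.logb (1 / q) n - 2 * Real.logb (1 / q) (Real.logb (1 / q) n) +
    Real.logb (1 / q) (Real.logb (1 / q) (Real.exp 1))

section Asymptotics
variable {q : ℝ}

lemma tendsto_logb_natCast (hq0 : 0 < q) (hq1 : q < 1) :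
    Tendsto (fun n : ℕ => Real.logb (1 / q) n) atTop atTop :=
  (Real.tendsto_logb_atTop (by rw [lt_div_iff₀ hq0]; linarith)).comp tendsto_natCast_atTop_atTop

lemma logb_one_div_eq (q x : ℝ) : Real.logb (1 / q) x = Real.log x / -Real.log q := by
  rw [Real.logb, one_div, Real.log_inv]

lemma log_eq_neg_log_mul_logb (hq0 : 0 < q) (hq1 : q < 1) (x : ℝ) :
    Real.log x = -Real.log q * Real.logb (1 / q) x := by
  have : -Real.log q ≠ 0 := by linarith [Real.log_neg hq0 hq1]
  rw [logb_one_div_eq, mul_div_cancel₀ _ this]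

/-- For the threshold `s` and `n` large, `n q ^ s` is the product of the logarithms of `n` to base
`1 / q` and to base `e`. This is the order of the logarithm of the number of sets of size about `s`,
which is why `s` is the threshold. -/
lemma natCast_mul_rpow_dominationThreshold (hq0 : 0 < q) (hq1 : q < 1) :
    ∀ᶠ n : ℕ in atTop,
      n * q ^ dominationThreshold q n = Real.logb (1 / q) n * Real.log n := by
  filter_upwards [(tendsto_logb_natCast hq0 hq1).eventually_gt_atTop 0, eventually_gt_atTop 0]
    with n hL hn
  have hn' : (0 : ℝ) < n := by exact_mod_cast hn
  have hlam : 0 < -Real.log q := by linarith [Real.log_neg hq0 hq1]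
  have h1 : Real.log n = Real.logb (1 / q) n * -Real.log q := by
    rw [log_eq_neg_log_mul_logb hq0 hq1]; ring
  set L := Real.logb (1 / q) n with hLdef
  have h2 : Real.log q * dominationThreshold q n =
      Real.log (L ^ 2 * -Real.log q / n) := by
    rw [Real.log_div (by positivity) hn'.ne', Real.log_mul (by positivity) hlam.ne', Real.log_pow,
      h1, dominationThreshold, ← hLdef, logb_one_div_eq q L, logb_one_div_eq q (Real.exp 1),
      logb_one_div_eq, Real.log_exp, one_div, Real.log_inv]
    have : Real.log q ≠ 0 := by linarith
    push_cast
    field_simp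
    ring
  rw [Real.rpow_def_of_pos hq0, h2, Real.exp_log (by positivity), h1]
  field_simp

lemma eventually_le_dominationThreshold (hq0 : 0 < q) (hq1 : q < 1) {c : ℝ} (hc : c < 1) :
    ∀ᶠ n : ℕ in atTop, c * Real.logb (1 / q) n ≤ dominationThreshold q n := by
  have hlam : 0 < -Real.log q := by linarith [Real.log_neg hq0 hq1]
  set K := Real.logb (1 / q) (Real.logb (1 / q) (Real.exp 1)) with hK
  have h1 : ∀ᶠ u : ℝ in atTop, c * u ≤ u - 2 * Real.logb (1 / q) u + K := by
    have ho := Real.isLittleO_log_id_atTop.def (c := (1 - c) / 4 * -Real.log q) (by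
      have : 0 < 1 - c := by linarith
      positivity)
    filter_upwards [ho, eventually_ge_atTop 1, eventually_ge_atTop (-K / ((1 - c) / 2))]
      with u hu hu1 huK
    rw [div_le_iff₀ (by linarith)] at huK
    rw [Real.norm_of_nonneg (Real.log_nonneg hu1), id, Real.norm_of_nonneg (by linarith)] at hu
    have : Real.logb (1 / q) u ≤ (1 - c) / 4 * u := by
      rw [logb_one_div_eq, div_le_iff₀ hlam]; linarith
    linarith
  exact (tendsto_logb_natCast hq0 hq1).eventually h1

lemma tendsto_dominationThreshold_sub (hq0 : 0 < q) (hq1 : q < 1) :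
    Tendsto (fun n : ℕ => dominationThreshold q n - Real.logb (1 / q) n) atTop atBot := by
  have hb : 1 < 1 / q := by rw [lt_div_iff₀ hq0]; linarith
  have h1 : Tendsto (fun n : ℕ => Real.logb (1 / q) (Real.logb (1 / q) n)) atTop atTop :=
    (Real.tendsto_logb_atTop hb).comp (tendsto_logb_natCast hq0 hq1)
  have h2 := tendsto_atBot_add_const_right atTop
    (Real.logb (1 / q) (Real.logb (1 / q) (Real.exp 1)))
    (h1.const_mul_atTop_of_neg (r := -2) (by norm_num))
  refine h2.congr fun n => ?_
  rw [dominationThreshold]; ring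

lemma tendsto_dominationThreshold (hq0 : 0 < q) (hq1 : q < 1) :
    Tendsto (dominationThreshold q) atTop atTop :=
  tendsto_atTop_mono' _ (eventually_le_dominationThreshold hq0 hq1 (c := 1 / 2) (by norm_num))
    ((tendsto_logb_natCast hq0 hq1).const_mul_atTop (by norm_num))

lemma tendsto_logb_pow_mul_rpow (q : ℝ) (j : ℕ) {c : ℝ} (hc : 0 < c) :
    Tendsto (fun n : ℕ => Real.logb (1 / q) n ^ j * (n : ℝ) ^ (-c)) atTop (𝓝 0) := by
  have h := (isLittleO_log_rpow_rpow_atTop (j : ℝ) hc).tendsto_div_nhds_zero.comp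
    tendsto_natCast_atTop_atTop
  have h2 := h.const_mul ((1 / -Real.log q) ^ j)
  rw [mul_zero] at h2
  refine h2.congr fun n => ?_
  simp only [Function.comp, Real.rpow_natCast]
  rw [logb_one_div_eq, Real.rpow_neg (by positivity)]
  simp only [div_eq_mul_inv]
  ring

lemma tendsto_logb_pow_div (q : ℝ) (j : ℕ) :
    Tendsto (fun n : ℕ => Real.logb (1 / q) n ^ j / n) atTop (𝓝 0) := by
  refine (tendsto_logb_pow_mul_rpow q j one_pos).congr fun n => ?_
  rw [Real.rpow_neg_one, ← div_eq_mul_inv]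

lemma eventually_floor_dominationThreshold (hq0 : 0 < q) (hq1 : q < 1) :
    ∀ᶠ n : ℕ in atTop, (⌊dominationThreshold q n⌋₊ : ℝ) ≤ dominationThreshold q n ∧
      dominationThreshold q n + 1 ≤ ⌊dominationThreshold q n⌋₊ + 2 ∧
      (⌊dominationThreshold q n⌋₊ + 2 : ℝ) ≤ Real.logb (1 / q) n := by
  filter_upwards [(tendsto_dominationThreshold hq0 hq1).eventually_ge_atTop 0,
    (tendsto_dominationThreshold_sub hq0 hq1).eventually_le_atBot (-2)] with n h0 h2
  have := Nat.floor_le h0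
  have := Nat.lt_floor_add_one (dominationThreshold q n)
  exact ⟨by linarith, by linarith, by linarith⟩

lemma eventually_logb_mul_le (q : ℝ) (c : ℝ) :
    ∀ᶠ n : ℕ in atTop, c * Real.logb (1 / q) n ≤ n := by
  have h := (tendsto_logb_pow_div q 1).const_mul c
  rw [mul_zero] at h
  filter_upwards [h.eventually_le_const one_pos, eventually_gt_atTop 0] with n hn hn0
  have hn' : (0 : ℝ) < n := by exact_mod_cast hn0
  rw [pow_one, mul_div_assoc', div_le_one hn'] at hn
  exact hn

end Asymptotics

variable (p : I)

/-- With high probability no set of size the integer part of the threshold is dominating. -/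
lemma tendsto_measureReal_exists_floor (hp0 : 0 < (p : ℝ)) (hp1 : (p : ℝ) < 1) :
    Tendsto (fun n : ℕ => (binomialRandom (Fin n) p).real {G | ∃ X : Finset (Fin n),
      G.IsDominatingSet X ∧ X.card = ⌊dominationThreshold (1 - p) n⌋₊}) atTop (𝓝 0) := by
  have hq0 : 0 < (1 - p : ℝ) := by linarith
  have hq1 : (1 - p : ℝ) < 1 := by linarith
  set q : ℝ := 1 - p with hq
  have hlam : 0 < -Real.log q := by linarith [Real.log_neg hq0 hq1]
  have hlog : Tendsto (fun n : ℕ => Real.log n) atTop atTop :=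
    Real.tendsto_log_atTop.comp tendsto_natCast_atTop_atTop
  have hexp : Tendsto (fun n : ℕ => Real.exp (Real.log n *
      (dominationThreshold q n - Real.logb (1 / q) n + 1 / -Real.log q))) atTop (𝓝 0) :=
    Real.tendsto_exp_atBot.comp (hlog.atTop_mul_atBot₀
      (tendsto_atBot_add_const_right _ _ (tendsto_dominationThreshold_sub hq0 hq1)))
  refine squeeze_zero' (.of_forall fun n => measureReal_nonneg) ?_ hexp
  filter_upwards [eventually_floor_dominationThreshold hq0 hq1,
    natCast_mul_rpow_dominationThreshold hq0 hq1, eventually_logb_mul_le q 1,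
    eventually_gt_atTop 0, hlog.eventually_ge_atTop 0] with n ⟨h1, h2, h3⟩ h4 h5 h6 h7
  set k := ⌊dominationThreshold q n⌋₊ with hk
  have hn' : (0 : ℝ) < n := by exact_mod_cast h6
  have hkn : k ≤ n := by
    have : (k : ℝ) ≤ n := by linarith
    exact_mod_cast this
  refine (first_moment_bound p hkn).trans ?_
  rw [← Real.rpow_natCast (n : ℝ) k, Real.rpow_def_of_pos hn', ← Real.exp_add, Real.exp_le_exp,
    ← hq]
  have h8 : q ^ dominationThreshold q n ≤ q ^ k := by
    rw [← Real.rpow_natCast]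
    exact Real.rpow_le_rpow_of_exponent_ge hq0 hq1.le h1
  have h9 : q ^ k ≤ 1 := pow_le_one₀ hq0.le hq1.le
  have h10 : n * q ^ dominationThreshold q n ≤ n * q ^ k := by gcongr
  have h11 : k * q ^ k ≤ Real.logb (1 / q) n :=
    (mul_le_of_le_one_right (by positivity) h9).trans (by linarith)
  have h12 : Real.log n * (1 / -Real.log q) = Real.logb (1 / q) n := by
    rw [logb_one_div_eq]; ring
  have h13 : Real.log n * k ≤ Real.log n * dominationThreshold q n := by gcongr
  rw [mul_add, h12]
  nlinarith

/-- With high probability no set of a certain logarithmic size covers a neighbourhood. -/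
lemma tendsto_measureReal_cover (hp0 : 0 < (p : ℝ)) (hp1 : (p : ℝ) < 1) :
    Tendsto (fun n : ℕ => (binomialRandom (Fin n) p).real {G | ¬ ∀ X : Finset (Fin n),
      X.card ≤ 2 * (⌊dominationThreshold (1 - p) n⌋₊ + 2) → ∀ v, ∃ u, u ∉ X ∧ G.Adj v u})
      atTop (𝓝 0) := by
  have hq0 : 0 < (1 - p : ℝ) := by linarith
  have hq1 : (1 - p : ℝ) < 1 := by linarith
  set q : ℝ := 1 - p with hq
  have hlam : 0 < -Real.log q := by linarith [Real.log_neg hq0 hq1]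
  have hexp : Tendsto (fun n : ℕ => Real.exp (n * (-Real.log q * (3 * (Real.logb (1 / q) n ^ 2 / n) +
      3 * (Real.logb (1 / q) n ^ 1 / n) - 1)))) atTop (𝓝 0) := by
    refine Real.tendsto_exp_atBot.comp (tendsto_natCast_atTop_atTop.atTop_mul_neg
      (C := -Real.log q * (3 * 0 + 3 * 0 - 1)) (by linarith) ?_)
    exact ((((tendsto_logb_pow_div q 2).const_mul 3).add
      ((tendsto_logb_pow_div q 1).const_mul 3)).sub_const 1).const_mul _
  refine squeeze_zero' (.of_forall fun n => measureReal_nonneg) ?_ hexp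
  filter_upwards [eventually_floor_dominationThreshold hq0 hq1, eventually_logb_mul_le q 3,
    eventually_gt_atTop 0, (tendsto_logb_natCast hq0 hq1).eventually_ge_atTop 1]
    with n ⟨h1, h2, h3⟩ h5 h6 h7
  set d := 2 * (⌊dominationThreshold q n⌋₊ + 2) with hd
  set L := Real.logb (1 / q) n with hL
  have hdL : ((d + 1 : ℕ) : ℝ) ≤ 3 * L := by rw [hd]; push_cast; linarith
  have hn' : (0 : ℝ) < n := by exact_mod_cast h6
  have hdn : d + 1 ≤ n := by exact_mod_cast hdL.trans h5
  have hlogn : Real.log n = -Real.log q * L := log_eq_neg_log_mul_logb hq0 hq1 _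
  refine (cover_neighborhood_bound p (d := d) hdn).trans ?_
  rw [← Real.rpow_natCast (n : ℝ), ← hq, ← Real.rpow_natCast q, Real.rpow_def_of_pos hn',
    Real.rpow_def_of_pos hq0, ← Real.exp_add, Real.exp_le_exp, Nat.cast_sub hdn, hlogn]
  have : n * (-Real.log q * (3 * (L ^ 2 / n) + 3 * (L ^ 1 / n) - 1)) =
      -Real.log q * (3 * L * (L + 1) - n) := by
    field_simp
  rw [this]
  have h8 : ((d + 1 : ℕ) : ℝ) * (L + 1) ≤ 3 * L * (L + 1) := by gcongr
  have h9 := mul_le_mul_of_nonneg_left h8 hlam.le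
  linarith

/-- With high probability some set of size two more than the integer part of the threshold is
dominating. -/
lemma tendsto_measureReal_exists_floor_add_two (hp0 : 0 < (p : ℝ)) (hp1 : (p : ℝ) < 1) :
    Tendsto (fun n : ℕ => (binomialRandom (Fin n) p).real {G | ∃ X : Finset (Fin n),
      G.IsDominatingSet X ∧ X.card = ⌊dominationThreshold (1 - p) n⌋₊ + 2}) atTop (𝓝 1) := by
  have hq0 : 0 < (1 - p : ℝ) := by linarith
  have hq1 : (1 - p : ℝ) < 1 := by linarith
  set q : ℝ := 1 - p with hq
  have hlam : 0 < -Real.log q := by linarith [Real.log_neg hq0 hq1]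
  set c : ℝ := (1 - q) / 2 with hc
  have hc0 : 0 < c := by rw [hc]; linarith
  have hy : Tendsto (fun n : ℕ => 2 * q * -Real.log q * (Real.logb (1 / q) n ^ 3 / n)) atTop
      (𝓝 0) := by
    simpa using (tendsto_logb_pow_div q 3).const_mul (2 * q * -Real.log q)
  have hz : Tendsto (fun n : ℕ => 2 * (Real.logb (1 / q) n ^ 2 * (n : ℝ) ^ (-c))) atTop
      (𝓝 0) := by
    simpa using (tendsto_logb_pow_mul_rpow q 2 hc0).const_mul 2
  have hlow : Tendsto (fun n : ℕ => (1 - 2 * q * -Real.log q * (Real.logb (1 / q) n ^ 3 / n)) *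
      Real.exp (-(2 * (Real.logb (1 / q) n ^ 2 * (n : ℝ) ^ (-c))))) atTop (𝓝 1) := by
    simpa using (hy.const_sub 1).mul ((Real.continuous_exp.tendsto _).comp hz.neg)
  refine tendsto_of_tendsto_of_tendsto_of_le_of_le' hlow tendsto_const_nhds ?_
    (.of_forall fun n => measureReal_le_one)
  filter_upwards [eventually_floor_dominationThreshold hq0 hq1, eventually_logb_mul_le q 2,
    eventually_gt_atTop 0, (tendsto_logb_natCast hq0 hq1).eventually_ge_atTop 1,
    natCast_mul_rpow_dominationThreshold hq0 hq1, hy.eventually_le_const one_pos,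
    eventually_le_dominationThreshold hq0 hq1 (c := q / ((1 + q) / 2))
      (by rw [div_lt_one (by linarith)]; linarith)]
    with n ⟨h1, h2, h3⟩ h5 h6 h7 h8 h9 h10
  set s := dominationThreshold q n with hs
  set r := ⌊s⌋₊ + 2 with hr
  set L := Real.logb (1 / q) n with hL
  have hn' : (0 : ℝ) < n := by exact_mod_cast h6
  have hrL : (r : ℝ) ≤ L := by rw [hr]; push_cast; exact h3
  have hsr : s + 1 ≤ r := by rw [hr]; push_cast; exact h2
  have hr0 : r ≠ 0 := by omega
  have hr' : (0 : ℝ) < r := by positivity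
  have hlogn : Real.log n = -Real.log q * L := log_eq_neg_log_mul_logb hq0 hq1 _
  have hs0 : 0 < s := lt_of_lt_of_le (by have : 0 < L := by linarith
                                         positivity) h10
  -- `y` is the probability that a given vertex has no neighbour in a given set of size `r`. As `r`
  -- exceeds the threshold by at least one, `n y` is smaller by a factor `q` than at the threshold.
  set y := q ^ r with hydef
  have hy0 : 0 < y := by positivity
  have hny : n * y ≤ q * (L * Real.log n) := by
    rw [← h8, hydef, ← Real.rpow_natCast q r]
    have : q ^ (r : ℝ) ≤ q ^ (s + 1) := Real.rpow_le_rpow_of_exponent_ge hq0 hq1.le hsr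
    rw [Real.rpow_add_one hq0.ne'] at this
    nlinarith
  have hry : 2 * r * y ≤ 2 * q * -Real.log q * (L ^ 3 / n) := by
    have : y ≤ q * (L * Real.log n) / n := by rw [le_div_iff₀ hn']; linarith
    calc 2 * r * y ≤ 2 * L * (q * (L * Real.log n) / n) := by gcongr
      _ = _ := by rw [hlogn]; ring
  have hry1 : 2 * r * y ≤ 1 := hry.trans h9
  have hr1 : (2 : ℝ) ≤ r := by rw [hr]; push_cast; linarith [(Nat.cast_nonneg ⌊s⌋₊ : (0 : ℝ) ≤ _)]
  have hy1 : y < 1 := by nlinarith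
  -- `m` is the size of the blocks whose transversals are counted.
  set m := n / r with hm
  have h2rn : 2 * r ≤ n := by
    have : ((2 * r : ℕ) : ℝ) ≤ n := by push_cast; linarith
    exact_mod_cast this
  have hmr : r * m ≤ n := Nat.mul_div_le n r
  have hm2 : (n : ℝ) ≤ 2 * r * m := by
    have h : n < r * m + r := by
      have := Nat.lt_mul_div_succ n (Nat.pos_of_ne_zero hr0)
      rw [← hm] at this; linarith
    have : n ≤ 2 * r * m := by nlinarith
    exact_mod_cast this
  have hm0 : m ≠ 0 := by
    rintro h
    rw [h] at hm2
    simp at hm2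
    omega
  have hm' : (0 : ℝ) < m := by positivity
  -- Any exponent strictly between `q` and `1` would do.
  set θ : ℝ := (n : ℝ) ^ ((1 + q) / 2) with hθ
  have hθ0 : 0 < θ := by positivity
  have hθle : Real.exp (n * y / (r * (1 - y))) ≤ θ := by
    rw [hθ, Real.rpow_def_of_pos hn', Real.exp_le_exp]
    have hden : s ≤ r * (1 - y) := by nlinarith
    have hlog0 : 0 ≤ Real.log n := by rw [hlogn]; nlinarith
    rw [div_mul_eq_mul_div, div_le_iff₀ (by linarith)] at h10
    rw [div_le_iff₀ (by linarith)]
    calc n * y ≤ (q * L) * Real.log n := by linarith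
      _ ≤ (s * ((1 + q) / 2)) * Real.log n := by gcongr
      _ ≤ (r * (1 - y) * ((1 + q) / 2)) * Real.log n := by gcongr
      _ = _ := by ring
  have hb := second_moment_bound p hp0 hp1 hr0 hm0 hmr hθle
  rw [← hq, ← hydef] at hb
  set P := (binomialRandom (Fin n) p).real
    {G | ∃ X : Finset (Fin n), G.IsDominatingSet X ∧ X.card = r} with hP
  have hP0 : 0 ≤ P := measureReal_nonneg
  have hθm : r * (θ / m) ≤ 2 * (L ^ 2 * (n : ℝ) ^ (-c)) := by
    have e1 : θ / n = (n : ℝ) ^ (-c) := by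
      rw [hθ, hc, ← Real.rpow_sub_one hn'.ne']; congr 1; ring
    rw [← e1]
    calc r * (θ / m) ≤ r * (θ * (2 * r / n)) := by
          gcongr
          rw [div_le_iff₀ hm', mul_assoc, div_mul_eq_mul_div]
          exact le_mul_of_one_le_right hθ0.le (by rw [le_div_iff₀ hn']; linarith)
      _ = 2 * (r ^ 2 * (θ / n)) := by ring
      _ ≤ _ := by gcongr
  have hpow : (m - 1 + θ) ^ r ≤ (m : ℝ) ^ r * Real.exp (2 * (L ^ 2 * (n : ℝ) ^ (-c))) := by
    have hm1 : (1 : ℝ) ≤ m := by exact_mod_cast Nat.one_le_iff_ne_zero.2 hm0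
    calc (m - 1 + θ) ^ r ≤ (m * (θ / m + 1)) ^ r := by
          gcongr
          rw [mul_add, mul_div_cancel₀ _ hm'.ne']; linarith
      _ ≤ (m * Real.exp (θ / m)) ^ r := by
          gcongr
          exact Real.add_one_le_exp _
      _ = (m : ℝ) ^ r * Real.exp (r * (θ / m)) := by
          rw [mul_pow, ← Real.exp_nat_mul]
      _ ≤ _ := by gcongr
  have hbern : 1 - 2 * q * -Real.log q * (L ^ 3 / n) ≤ (1 - y) ^ (2 * r) := by
    have := one_add_mul_le_pow (a := -y) (by linarith) (2 * r)
    push_cast at this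
    rw [← sub_eq_add_neg] at this
    linarith
  have hfin : (1 - y) ^ (2 * r) ≤ P * Real.exp (2 * (L ^ 2 * (n : ℝ) ^ (-c))) := by
    refine le_of_mul_le_mul_right ?_ (pow_pos hm' r)
    calc (1 - y) ^ (2 * r) * (m : ℝ) ^ r ≤ (m - 1 + θ) ^ r * P := hb
      _ ≤ ((m : ℝ) ^ r * Real.exp (2 * (L ^ 2 * (n : ℝ) ^ (-c)))) * P := by gcongr
      _ = _ := by ring
  rw [Real.exp_neg, ← div_eq_mul_inv, div_le_iff₀ (Real.exp_pos _)]
  exact hbern.trans hfin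

end SimpleGraph

/-! ### The domination numbers of almost every graph -/

theorem theorem14 (p : ℝ) (hp0 : 0 < p) (hp1 : p < 1) :
    SimpleGraph.AlmostEvery ⟨p, hp0.le, hp1.le⟩ (fun n G =>
      G.restrainedDominationNumber = G.dominationNumber ∧
      -- total (restrained) dominating sets exist, so that their minimum sizes are meaningful
      (∃ X : Finset (Fin n), G.IsTotalRestrainedDominatingSet X) ∧
      G.totalRestrainedDominationNumber = G.totalDominationNumber ∧
      ∃ ε : ℤ, (ε = 1 ∨ ε = 2) ∧
        (G.restrainedDominationNumber : ℤ) =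
          ⌊Real.logb (1 / (1 - p)) n
            - 2 * Real.logb (1 / (1 - p)) (Real.logb (1 / (1 - p)) n)
            + Real.logb (1 / (1 - p)) (Real.logb (1 / (1 - p)) (Real.exp 1))⌋ + ε) := by
  set P : unitInterval := ⟨p, hp0.le, hp1.le⟩
  have hPp : (P : ℝ) = p := rfl
  have hq0 : 0 < 1 - p := by linarith
  have hq1 : 1 - p < 1 := by linarith
  have hA := SimpleGraph.tendsto_measureReal_cover P hp0 hp1
  have hB := SimpleGraph.tendsto_measureReal_exists_floor P hp0 hp1
  have hC := SimpleGraph.tendsto_measureReal_exists_floor_add_two P hp0 hp1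
  rw [hPp] at hA hB hC
  have hlim := (hC.sub hB).sub hA
  rw [sub_zero, sub_zero] at hlim
  rw [SimpleGraph.AlmostEvery, ← ENNReal.tendsto_toReal_iff (by finiteness) (by simp)]
  refine tendsto_of_tendsto_of_tendsto_of_le_of_le' hlim
    tendsto_const_nhds ?_ (.of_forall fun n => measureReal_le_one)
  filter_upwards [SimpleGraph.eventually_floor_dominationThreshold hq0 hq1,
    SimpleGraph.eventually_logb_mul_le (1 - p) 1,
    (SimpleGraph.tendsto_dominationThreshold hq0 hq1).eventually_ge_atTop 0]
    with n ⟨h1, h2, h3⟩ h4 h5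
  set k := ⌊SimpleGraph.dominationThreshold (1 - p) n⌋₊
  have hkn : k ≤ n := by
    have : (k : ℝ) ≤ n := by linarith
    exact_mod_cast this
  have hfl : ⌊SimpleGraph.dominationThreshold (1 - p) n⌋ = (k : ℤ) :=
    (Int.natCast_floor_eq_floor h5).symm
  refine measureReal_sub_sub_le fun G hG => ?_
  by_cases hno : ∃ X : Finset (Fin n), G.IsDominatingSet X ∧ X.card = k
  · exact .inl (.inr hno)
  by_cases hdeg : ∀ X : Finset (Fin n), X.card ≤ 2 * (k + 2) → ∀ v, ∃ u, u ∉ X ∧ G.Adj v u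
  · obtain ⟨c1, c2, c3, c4⟩ := SimpleGraph.dominationNumbers_of_expansion (by simpa using hkn)
      hdeg hno hG
    refine .inl (.inl ⟨c1, c2, c3, ?_⟩)
    rw [SimpleGraph.dominationThreshold] at hfl
    rw [hfl]
    rcases c4 with c4 | c4
    · exact ⟨1, .inl rfl, by rw [c4]; push_cast; ring⟩
    · exact ⟨2, .inr rfl, by rw [c4]; push_cast; ring⟩
  · exact .inr hdeg
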